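/- Let $M_n$ denote the $n\times n$ complex matrices and let $\langle x,y\rangle$ be the standard inner product of $\mathbb C^n$, linear in $x$. For $A\in M_n$ and $q\in\mathbb C$ with $|q|\le 1$, the $q$-numerical radius is $$w_q(A)=\sup\{|\langle Ax,y\rangle| : x,y\in\mathbb C^n,\ \|x\|=\|y\|=1,\ \langle x,y\rangle=q\}$$ (with $\sup\emptyset=0$, which matters only when $n=1$ and $|q|<1$). For $\alpha\in[0,\pi/2)$, a matrix $A\in M_n$ is called sectorial with index $\alpha$ if $\operatorname{Re}z>0$ and $|\operatorname{Im}z|\le \tan(\alpha)\operatorname{Re}z$ for every $z$ in its numerical range $\{\langle Ax,x\rangle:\|x\|=1\}$. For such $A$ and $t\in(0,1)$, put $$A^t=\int_0^1\big((1-s)I+sA^{-1}\big)^{-1}\,d\nu_t(s),\qquad d\nu_t(s)=\frac{\sin(\pi t)}{\pi}\,s^{t-1}(1-s)^{-t}\,ds,$$ where $\nu_t$ is the probability measure on $[0,1]$ with $x^t=\int_0^1((1-s)+sx^{-1})^{-1}\,d\nu_t(s)$ for all $x>0$. Let $\alpha\in[0,\pi/2)$, let $A,B\in M_n$ be sectorial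 with index $\alpha$, let $q\in\mathbb C$ with $|q|\le1$, and let $t\in(0,1)$. Then (a) $|q|^2\cos(\alpha)\,w_q(A)^t\le |q|\,w_q(A^t)\le \sec^3(\alpha)\,w_q(A)^t$; (b) $|q|\,w_q\big((1-\gamma)A^t+\gamma B^t\big)\le \sec^3(\alpha)\,\big((1-\gamma)w_q(A)+\gamma w_q(B)\big)^t$ for every $\gamma\in(0,1)$; (c) $|q|\,w_q\big((A+B)^t\big)\le\sec^3(\alpha)\,w_q(A^t+B^t)$. -/

import Mathlib

/-- The numerical range `W(A) = {⟨Ax, x⟩ : ‖x‖ = 1}` of a square complex matrix. Mathlib's inner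
product is conjugate-linear in its first argument, so the textbook `⟨u, v⟩` (linear in `u`) is
`inner ℂ v u`. -/
def matNumericalRange {n : ℕ} (A : Matrix (Fin n) (Fin n) ℂ) : Set ℂ :=
  {z | ∃ x : EuclideanSpace ℂ (Fin n), ‖x‖ = 1 ∧ z = inner ℂ x (Matrix.toEuclideanCLM (𝕜 := ℂ) A x)}

/-- The `q`-numerical range `W_q(A) = {⟨Ax, y⟩ : ‖x‖ = ‖y‖ = 1, ⟨x, y⟩ = q}`. -/
def qNumericalRange {n : ℕ} (q : ℂ) (A : Matrix (Fin n) (Fin n) ℂ) : Set ℂ :=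
  {z | ∃ x y : EuclideanSpace ℂ (Fin n), ‖x‖ = 1 ∧ ‖y‖ = 1 ∧ inner ℂ y x = q ∧
    z = inner ℂ y (Matrix.toEuclideanCLM (𝕜 := ℂ) A x)}

/-- The `q`-numerical radius `w_q(A) = sup {|z| : z ∈ W_q(A)}` (the set is always bounded; the
supremum of the empty set is `0`). -/
noncomputable def qNumericalRadius {n : ℕ} (q : ℂ) (A : Matrix (Fin n) (Fin n) ℂ) : ℝ :=
  sSup ((fun z : ℂ => ‖z‖) '' qNumericalRange q A)

/-- The sector `S_α = {z : Re z > 0, |Im z| ≤ tan(α) Re z}`. -/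
def sector (α : ℝ) : Set ℂ :=
  {z | 0 < z.re ∧ |z.im| ≤ Real.tan α * z.re}

/-- `A` is sectorial with index `α`: `W(A) ⊆ S_α`. -/
def IsSectorial {n : ℕ} (α : ℝ) (A : Matrix (Fin n) (Fin n) ℂ) : Prop :=
  matNumericalRange A ⊆ sector α

/-- The matrix `f(A) = ∫ ((1 - s) I + s A⁻¹)⁻¹ dν(s)` (entrywise integral) attached to a measure
`ν` on `[0, 1]`, where `ν` represents the operator monotone function
`f(x) = ∫ ((1 - s) + s x⁻¹)⁻¹ dν(s)`, `x > 0`. -/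
noncomputable def matOfMeasure {n : ℕ} (ν : MeasureTheory.Measure ℝ)
    (A : Matrix (Fin n) (Fin n) ℂ) : Matrix (Fin n) (Fin n) ℂ :=
  Matrix.of fun i j =>
    ∫ s : ℝ in Set.Icc 0 1, ((1 - s) • (1 : Matrix (Fin n) (Fin n) ℂ) + s • A⁻¹)⁻¹ i j ∂ν

/-- The probability measure `(sin (π t) / π) s ^ (t - 1) (1 - s) ^ (- t) ds` on `(0, 1)`, that is,
the Beta distribution with parameters `t` and `1 - t`; it represents `x ↦ x ^ t`
(see `rpow_eq_integral_rpowMeasure`). -/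
noncomputable def rpowMeasure (t : ℝ) : MeasureTheory.Measure ℝ :=
  ProbabilityTheory.betaMeasure t (1 - t)

/-- The fractional power `A ^ t`, `0 < t < 1`, of a matrix `A` with `W(A)` in the open right half
plane: `A ^ t = f(A)` for `f(x) = x ^ t`. -/
noncomputable def matRpow {n : ℕ} (A : Matrix (Fin n) (Fin n) ℂ) (t : ℝ) :
    Matrix (Fin n) (Fin n) ℂ :=
  matOfMeasure (rpowMeasure t) A

theorem isProbabilityMeasure_rpowMeasure {t : ℝ} (ht : t ∈ Set.Ioo (0 : ℝ) 1) :
    MeasureTheory.IsProbabilityMeasure (rpowMeasure t) :=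
  ProbabilityTheory.isProbabilityMeasureBeta ht.1 (by linarith [ht.2])

theorem integral_rpowMeasure {t : ℝ} (ht : t ∈ Set.Ioo (0 : ℝ) 1) (f : ℝ → ℝ) :
    ∫ s in Set.Icc 0 1, f s ∂(rpowMeasure t) =
      ∫ s in Set.Ioo 0 1, (1 / ProbabilityTheory.beta t (1 - t) * s ^ (t - 1) *
        (1 - s) ^ (1 - t - 1)) * f s := by
  have h0 : (1 : ℝ) - t > 0 := by linarith [ht.2]
  have hm : Measurable (ProbabilityTheory.betaPDF t (1 - t)) :=
    (ProbabilityTheory.measurable_betaPDFReal _ _).ennreal_ofReal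
  rw [rpowMeasure, ProbabilityTheory.betaMeasure, MeasureTheory.restrict_withDensity measurableSet_Icc,
    integral_withDensity_eq_integral_toReal_smul hm
      (Filter.Eventually.of_forall fun _ => ENNReal.ofReal_lt_top),
    MeasureTheory.integral_Icc_eq_integral_Ioo]
  refine MeasureTheory.setIntegral_congr_fun measurableSet_Ioo fun s hs => ?_
  have hb := ProbabilityTheory.beta_pos ht.1 h0
  have h1 : 0 < 1 - s := by linarith [hs.2]
  have h2 := hs.1
  simp only [smul_eq_mul]
  rw [ProbabilityTheory.betaPDF_of_pos_lt_one hs.1 hs.2, ENNReal.toReal_ofReal (by positivity)]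

theorem rpowMeasure_compl_Icc (t : ℝ) : rpowMeasure t (Set.Icc 0 1)ᶜ = 0 := by
  rw [rpowMeasure, ProbabilityTheory.betaMeasure,
    MeasureTheory.withDensity_apply _ measurableSet_Icc.compl,
    MeasureTheory.setLIntegral_congr_fun (g := fun _ => 0) measurableSet_Icc.compl]
  · simp
  · intro s hs
    rcases not_and_or.1 hs with h | h
    · exact ProbabilityTheory.betaPDF_eq_zero_of_nonpos (not_le.1 h).le
    · exact ProbabilityTheory.betaPDF_eq_zero_of_one_le (not_le.1 h).le

theorem rpow_eq_integral_rpowMeasure {t : ℝ} (ht : t ∈ Set.Ioo (0 : ℝ) 1) {x : ℝ} (hx : 0 < x) :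
    x ^ t = ∫ s in Set.Icc 0 1, ((1 - s) + s * x⁻¹)⁻¹ ∂(rpowMeasure t) := by
  have h0 : (1 : ℝ) - t > 0 := by linarith [ht.2]
  have hb := ProbabilityTheory.beta_pos ht.1 h0
  have key : ∀ x : ℝ, 0 < x → ∫ s in Set.Icc 0 1, ((1 - s) + s * x⁻¹)⁻¹ ∂(rpowMeasure t) =
      1 / ProbabilityTheory.beta t (1 - t) * ∫ u in Set.Ioi 0, Real.rpowIntegrand₀₁ t u x := by
    intro x hx
    have himg : (fun s : ℝ => s / (1 - s)) '' Set.Ioo 0 1 = Set.Ioi 0 := by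
      ext u
      simp only [Set.mem_image, Set.mem_Ioo, Set.mem_Ioi]
      constructor
      · rintro ⟨s, ⟨h1, h2⟩, rfl⟩
        exact div_pos h1 (by linarith)
      · intro hu
        refine ⟨u / (1 + u), ⟨by positivity, ?_⟩, ?_⟩
        · rw [div_lt_one (by positivity)]; linarith
        · field_simp
          ring
    have hder : ∀ s ∈ Set.Ioo (0 : ℝ) 1,
        HasDerivWithinAt (fun s : ℝ => s / (1 - s)) (1 / (1 - s) ^ 2) (Set.Ioo 0 1) s := by
      intro s hs
      have h1 : (1 : ℝ) - s ≠ 0 := by linarith [hs.2]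
      have h2 := ((hasDerivAt_id' s).fun_div ((hasDerivAt_id' s).const_sub 1) h1).hasDerivWithinAt
        (s := Set.Ioo 0 1)
      rwa [show (1 * (1 - s) - s * -1 : ℝ) = 1 by ring] at h2
    have hinj : Set.InjOn (fun s : ℝ => s / (1 - s)) (Set.Ioo 0 1) := by
      intro a ha b hb hab
      have h1 : (1 : ℝ) - a ≠ 0 := by linarith [ha.2]
      have h2 : (1 : ℝ) - b ≠ 0 := by linarith [hb.2]
      beta_reduce at hab
      rw [div_eq_div_iff h1 h2] at hab
      linarith
    rw [integral_rpowMeasure ht, ← himg,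
      MeasureTheory.integral_image_eq_integral_abs_deriv_smul measurableSet_Ioo hder hinj,
      ← MeasureTheory.integral_const_mul]
    refine MeasureTheory.setIntegral_congr_fun measurableSet_Ioo fun s hs => ?_
    have h1 : 0 < 1 - s := by linarith [hs.2]
    have h2 := hs.1
    simp only [smul_eq_mul]
    rw [Real.rpowIntegrand₀₁_eq_pow_div ht (by positivity) hx.le, abs_of_pos (by positivity),
      Real.div_rpow h2.le h1.le, show (1 : ℝ) - t - 1 = -(t - 1) - 1 by ring,
      Real.rpow_sub_one h1.ne', Real.rpow_neg h1.le]
    have h3 : 0 < (1 - s) ^ (t - 1) := by positivity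
    have h4 : 0 < s / (1 - s) + x := by positivity
    have h5 : 0 < (1 - s) + s * x⁻¹ := by positivity
    field_simp
    ring
  have := isProbabilityMeasure_rpowMeasure ht
  have hmass : ∫ s in Set.Icc 0 1, (1 : ℝ) ∂(rpowMeasure t) = 1 := by
    rw [MeasureTheory.integral_const, smul_eq_mul, mul_one, MeasureTheory.measureReal_def,
      MeasureTheory.Measure.restrict_apply_univ,
      (MeasureTheory.prob_compl_eq_zero_iff measurableSet_Icc).1 (rpowMeasure_compl_Icc t),
      ENNReal.toReal_one]
  have k1 := key 1 one_pos
  have e1 : ∫ s in Set.Icc 0 1, ((1 - s) + s * (1 : ℝ)⁻¹)⁻¹ ∂(rpowMeasure t) = 1 := by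
    simpa using hmass
  rw [key x hx, Real.rpow_eq_const_mul_integral ht hx.le]
  rw [e1] at k1
  congr 1
  exact inv_eq_of_mul_eq_one_left k1.symm

/-! Everything is compared with `M`, the maximum of `Re ⟨Au, u⟩` over unit vectors. Write `A = R +
iK` with `R`, `K` self-adjoint. Sectoriality gives `|K| ≤ tan α · R` as forms, and hence `A* A ≤
sec² α · M · R` (`norm_sq_map_le_of_sectorial`). This bounds each resolvent in the integral for
`A^t` by the scalar integrand at `N = sec² α · M` (`norm_resolvent_le`), so integration gives `‖A^t‖
≤ N^t ≤ sec³ α · M^t`.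

In the other direction, whenever `Re A ≤ M`, completing squares in the resolvent gives `Re A^t ≥
M^(t-1) Re A` (`inner_resolvent_ge`). This is sharp enough to give `M^t` at a maximizing vector, and
since it is linear in `A` for fixed `M` it can be summed over `A` and `B`.

The `q`-radius enters only through `|q| M ≤ w_q(A) ≤ sec α · M`; the left half comes from
`norm_mul_norm_inner_le_qNumericalRadius`. The three claims then follow from monotonicity and
concavity of `x ↦ x^t`. -/

/-! ### Form inequalities for sectorial operators and their resolvents. -/

section SesquilinearForms

variable {E : Type*} [NormedAddCommGroup E] [InnerProductSpace ℂ E]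

open scoped InnerProductSpace

theorem inner_sub_left_map_expand {R : E →L[ℂ] E}
    (hR : ∀ u v, ⟪R u, v⟫_ℂ = ⟪u, R v⟫_ℂ) (u v : E) :
    (⟪u - v, R (u - v)⟫_ℂ).re = (⟪u, R u⟫_ℂ).re - 2 * (⟪v, R u⟫_ℂ).re + (⟪v, R v⟫_ℂ).re := by
  have h : (⟪u, R v⟫_ℂ).re = (⟪v, R u⟫_ℂ).re := by
    rw [← hR, ← inner_conj_symm, Complex.conj_re]
  simp only [map_sub, inner_sub_left, inner_sub_right, Complex.sub_re, h]
  ring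

theorem inner_add_left_map_expand {R : E →L[ℂ] E}
    (hR : ∀ u v, ⟪R u, v⟫_ℂ = ⟪u, R v⟫_ℂ) (u v : E) :
    (⟪u + v, R (u + v)⟫_ℂ).re = (⟪u, R u⟫_ℂ).re + 2 * (⟪v, R u⟫_ℂ).re + (⟪v, R v⟫_ℂ).re := by
  have h := inner_sub_left_map_expand hR u (-v)
  simpa only [sub_neg_eq_add, inner_neg_left, map_neg, inner_neg_right, neg_neg, Complex.neg_re,
    mul_neg] using h

theorem inner_real_smul_map (R : E →L[ℂ] E) (c : ℝ) (u v : E) :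
    (⟪((c : ℂ) • u), R v⟫_ℂ).re = c * (⟪u, R v⟫_ℂ).re := by
  simp

theorem inner_map_real_smul (R : E →L[ℂ] E) (c : ℝ) (u v : E) :
    (⟪u, R ((c : ℂ) • v)⟫_ℂ).re = c * (⟪u, R v⟫_ℂ).re := by
  simp

/-- A positive operator `R ≤ M` satisfies `R ^ 2 ≤ M R`. -/
theorem norm_sq_map_le_of_symmetric {R : E →L[ℂ] E}
    (hR : ∀ u v, ⟪R u, v⟫_ℂ = ⟪u, R v⟫_ℂ) {M : ℝ} (hM : 0 < M)
    (h0 : ∀ u, 0 ≤ (⟪u, R u⟫_ℂ).re) (h1 : ∀ u, (⟪u, R u⟫_ℂ).re ≤ M * ‖u‖ ^ 2) (u : E) :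
    ‖R u‖ ^ 2 ≤ M * (⟪u, R u⟫_ℂ).re := by
  -- Positivity at `u - M⁻¹ R u` produces `-2 M⁻¹ ‖R u‖²`, half of which absorbs the term quadratic
  -- in `R u`, by `R ≤ M`.
  have h2 := h0 (u - ((M⁻¹ : ℝ) : ℂ) • R u)
  rw [inner_sub_left_map_expand hR, inner_real_smul_map, inner_real_smul_map,
    inner_map_real_smul] at h2
  have h3 : (⟪R u, R u⟫_ℂ).re = ‖R u‖ ^ 2 := inner_self_eq_norm_sq (𝕜 := ℂ) (R u)
  have h4 := h1 (R u)
  rw [h3] at h2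
  have h5 : M⁻¹ * (M⁻¹ * (⟪R u, R (R u)⟫_ℂ).re) ≤ M⁻¹ * ‖R u‖ ^ 2 := by
    gcongr
    rw [inv_mul_le_iff₀ hM]
    exact h4
  have h6 : M⁻¹ * ‖R u‖ ^ 2 ≤ (⟪u, R u⟫_ℂ).re := by linarith
  rwa [inv_mul_le_iff₀ hM] at h6

/-- If `K` is dominated by `τ R` and `R w = K u`, then `⟪w, R w⟫ ≤ τ ^ 2 ⟪u, R u⟫`. -/
theorem inner_map_le_of_dominated {R K : E →L[ℂ] E}
    (hR : ∀ u v, ⟪R u, v⟫_ℂ = ⟪u, R v⟫_ℂ) (hK : ∀ u v, ⟪K u, v⟫_ℂ = ⟪u, K v⟫_ℂ)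
    {τ : ℝ} (hτ : 0 ≤ τ)
    (h1 : ∀ u, |(⟪u, K u⟫_ℂ).re| ≤ τ * (⟪u, R u⟫_ℂ).re) {u w : E} (hw : R w = K u) :
    (⟪w, R w⟫_ℂ).re ≤ τ ^ 2 * (⟪u, R u⟫_ℂ).re := by
  -- Polarization: subtract the domination bounds at `v + w` and `v - w`.
  have key : ∀ v : E, 2 * (⟪w, K v⟫_ℂ).re ≤ τ * ((⟪v, R v⟫_ℂ).re + (⟪w, R w⟫_ℂ).re) := by
    intro v
    have a := (abs_le.1 (h1 (v + w))).2
    have b := (abs_le.1 (h1 (v - w))).1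
    rw [inner_add_left_map_expand hR, inner_add_left_map_expand hK] at a
    rw [inner_sub_left_map_expand hR, inner_sub_left_map_expand hK] at b
    linarith
  -- The choice `v = τ u` turns `K v` into `τ R w`; a factor `τ` is then cancelled, so `τ = 0` is
  -- separate.
  rcases hτ.eq_or_lt with rfl | hτ
  · have := key u
    rw [← hw] at this
    linarith
  · have := key ((τ : ℂ) • u)
    rw [inner_map_real_smul, inner_map_real_smul, inner_real_smul_map, ← hw] at this
    nlinarith [le_of_mul_le_mul_left (a := τ) (b := 2 * (⟪w, R w⟫_ℂ).re)
      (c := τ * (τ * (⟪u, R u⟫_ℂ).re) + (⟪w, R w⟫_ℂ).re) (by linarith) hτ]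

/-- Pair `x` with `T z`: the hypothesis bounds the real part below by `((1 - s) + s N⁻¹) ‖T z‖²`,
and Cauchy–Schwarz bounds it above. With `z = T⁻¹ y`, the vector `T z = y` is the resolvent `((1 -
s) + s T⁻¹)⁻¹ x`, so no inverse has to appear. -/
theorem norm_resolvent_le {T : E →L[ℂ] E} {N s : ℝ} (hN : 0 < N) (hs : s ∈ Set.Icc (0 : ℝ) 1)
    (h : ∀ u, ‖T u‖ ^ 2 ≤ N * (⟪u, T u⟫_ℂ).re) {x z : E}
    (hx : x = ((1 - s : ℝ) : ℂ) • T z + (s : ℂ) • z) :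
    ‖T z‖ ≤ ‖x‖ * ((1 - s) + s * N⁻¹)⁻¹ := by
  have hc : 0 < (1 - s) + s * N⁻¹ := by
    have := hs.1
    have := inv_pos.2 hN
    rcases hs.2.eq_or_lt with rfl | h1
    · simpa using hN
    · have : 0 < 1 - s := by linarith
      positivity
  have h1 : (⟪T z, x⟫_ℂ).re = (1 - s) * ‖T z‖ ^ 2 + s * (⟪z, T z⟫_ℂ).re := by
    have h2 : (⟪T z, z⟫_ℂ).re = (⟪z, T z⟫_ℂ).re := by rw [← inner_conj_symm, Complex.conj_re]
    have h3 : (⟪T z, T z⟫_ℂ).re = ‖T z‖ ^ 2 := inner_self_eq_norm_sq (𝕜 := ℂ) (T z)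
    rw [hx, inner_add_right, inner_smul_right, inner_smul_right, Complex.add_re,
      Complex.re_ofReal_mul, Complex.re_ofReal_mul, h2, h3]
  have h2 : (⟪T z, x⟫_ℂ).re ≤ ‖T z‖ * ‖x‖ :=
    (Complex.re_le_norm _).trans (norm_inner_le_norm _ _)
  have h3 : N⁻¹ * ‖T z‖ ^ 2 ≤ (⟪z, T z⟫_ℂ).re := by
    rw [inv_mul_le_iff₀ hN]; exact h z
  have h4 := mul_le_mul_of_nonneg_left h3 hs.1
  rw [← div_eq_mul_inv, le_div_iff₀ hc]
  rcases (norm_nonneg (T z)).eq_or_lt with h5 | h5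
  · rw [← h5]; simp
  · refine le_of_mul_le_mul_left ?_ h5
    nlinarith

variable [FiniteDimensional ℂ E]

noncomputable def operatorRealPart (T : E →L[ℂ] E) : E →L[ℂ] E :=
  (1 / 2 : ℂ) • (T + ContinuousLinearMap.adjoint T)

noncomputable def operatorImagPart (T : E →L[ℂ] E) : E →L[ℂ] E :=
  (-Complex.I / 2) • (T - ContinuousLinearMap.adjoint T)

theorem operatorRealPart_symm (T : E →L[ℂ] E) (u v : E) :
    ⟪operatorRealPart T u, v⟫_ℂ = ⟪u, operatorRealPart T v⟫_ℂ := by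
  simp [operatorRealPart, ContinuousLinearMap.adjoint_inner_left, ContinuousLinearMap.adjoint_inner_right]
  ring

theorem operatorImagPart_symm (T : E →L[ℂ] E) (u v : E) :
    ⟪operatorImagPart T u, v⟫_ℂ = ⟪u, operatorImagPart T v⟫_ℂ := by
  simp [operatorImagPart, ContinuousLinearMap.adjoint_inner_left, ContinuousLinearMap.adjoint_inner_right]
  ring

theorem operatorRealPart_add_operatorImagPart (T : E →L[ℂ] E) (u : E) :
    T u = operatorRealPart T u + Complex.I • operatorImagPart T u := by
  have h : Complex.I * (-Complex.I / 2) = 1 / 2 := by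
    rw [mul_div_assoc', mul_neg, Complex.I_mul_I, neg_neg]
  simp only [operatorRealPart, operatorImagPart, smul_apply, add_apply,
    sub_apply, smul_smul, h]
  module

theorem inner_operatorRealPart (T : E →L[ℂ] E) (u : E) :
    (⟪u, operatorRealPart T u⟫_ℂ).re = (⟪u, T u⟫_ℂ).re := by
  have h : (⟪u, ContinuousLinearMap.adjoint T u⟫_ℂ).re = (⟪u, T u⟫_ℂ).re := by
    rw [ContinuousLinearMap.adjoint_inner_right, ← inner_conj_symm, Complex.conj_re]
  have h' : (1 / 2 : ℂ) = ((1 / 2 : ℝ) : ℂ) := by norm_num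
  rw [operatorRealPart, smul_apply, inner_smul_right, h', Complex.re_ofReal_mul,
    add_apply, inner_add_right, Complex.add_re, h]
  ring

theorem inner_operatorImagPart (T : E →L[ℂ] E) (u : E) :
    (⟪u, operatorImagPart T u⟫_ℂ).re = (⟪u, T u⟫_ℂ).im := by
  have h0 : (⟪u, operatorRealPart T u⟫_ℂ).im = 0 := by
    rw [← Complex.conj_eq_iff_im, inner_conj_symm, operatorRealPart_symm]
  rw [operatorRealPart_add_operatorImagPart T u, inner_add_right, inner_smul_right]
  simp [h0]

/-- `A ^* A ≤ (1 + τ ^ 2) M Re A` for an operator with `|Im A| ≤ τ Re A`, `Re A ≤ M`. -/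
theorem norm_sq_map_le_of_sectorial {T : E →L[ℂ] E} {M τ : ℝ} (hM : 0 < M) (hτ : 0 ≤ τ)
    (h0 : ∀ u, u ≠ 0 → 0 < (⟪u, T u⟫_ℂ).re) (h1 : ∀ u, (⟪u, T u⟫_ℂ).re ≤ M * ‖u‖ ^ 2)
    (h2 : ∀ u, |(⟪u, T u⟫_ℂ).im| ≤ τ * (⟪u, T u⟫_ℂ).re) (u : E) :
    ‖T u‖ ^ 2 ≤ (1 + τ ^ 2) * M * (⟪u, T u⟫_ℂ).re := by
  have hR := operatorRealPart_symm T
  have hK := operatorImagPart_symm T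
  have h0' : ∀ u, 0 ≤ (⟪u, operatorRealPart T u⟫_ℂ).re := by
    intro u
    rcases eq_or_ne u 0 with rfl | hu
    · simp
    · rw [inner_operatorRealPart]
      exact (h0 u hu).le
  have hsurj : Function.Surjective (operatorRealPart T) := by
    have hinj : Function.Injective (operatorRealPart T : E →ₗ[ℂ] E) := by
      rw [injective_iff_map_eq_zero]
      intro v hv
      by_contra hne
      have h3 := h0 v hne
      rw [← inner_operatorRealPart] at h3
      have hv' : operatorRealPart T v = 0 := hv
      simp [hv'] at h3
    exact LinearMap.injective_iff_surjective.1 hinj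
  -- With `R`, `K` the real and imaginary parts, `w = R⁻¹ K u` gives `T u = R (u + i w)`, so the
  -- bound for positive operators applies to `T u`.
  obtain ⟨w, hw⟩ := hsurj (operatorImagPart T u)
  have h3 := inner_map_le_of_dominated hR hK hτ
    (fun u => by rw [inner_operatorImagPart, inner_operatorRealPart]; exact h2 u) hw
  have h4 : T u = operatorRealPart T (u + Complex.I • w) := by
    rw [map_add, map_smul, hw]
    exact operatorRealPart_add_operatorImagPart T u
  have h5 := norm_sq_map_le_of_symmetric hR hM h0'
    (fun u => by rw [inner_operatorRealPart]; exact h1 u) (u + Complex.I • w)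
  rw [inner_add_left_map_expand hR, ← h4] at h5
  -- The cross term is imaginary, because `⟪w, R u⟫ = ⟪K u, u⟫` is real.
  have h6 : (⟪Complex.I • w, operatorRealPart T u⟫_ℂ).re = 0 := by
    have him : (⟪u, operatorImagPart T u⟫_ℂ).im = 0 := by
      rw [← Complex.conj_eq_iff_im, inner_conj_symm, hK]
    have h7 : ⟪w, operatorRealPart T u⟫_ℂ = ⟪operatorImagPart T u, u⟫_ℂ := by rw [← hR, hw]
    rw [inner_smul_left, h7, hK]
    simp [him]
  have h7 : (⟪Complex.I • w, operatorRealPart T (Complex.I • w)⟫_ℂ).re = (⟪w, operatorRealPart T w⟫_ℂ).re := by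
    rw [map_smul, inner_smul_left, inner_smul_right, ← mul_assoc, Complex.conj_I, neg_mul,
      Complex.I_mul_I, neg_neg, one_mul]
  rw [h6, h7] at h5
  rw [← inner_operatorRealPart]
  nlinarith

/-- The right side equals `(1 - s) ‖T z‖² + s ⟪z, R z⟫` with `R = Re T`. Completing squares around
`l R x` and `l x` bounds it below by `2 l ⟪x, R x⟫ - l² ((1 - s) ‖R x‖² + s ⟪x, R x⟫)`. By `R² ≤ M
R` and the choice `l = ((1 - s) M + s)⁻¹`, this is at least `l ⟪x, R x⟫`. Only `0 ≤ Re T ≤ M` is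
used, with no sector condition. -/
theorem inner_resolvent_ge {T : E →L[ℂ] E} {M s : ℝ} (hM : 0 < M) (hs : s ∈ Set.Icc (0 : ℝ) 1)
    (h0 : ∀ u, 0 ≤ (⟪u, T u⟫_ℂ).re) (h1 : ∀ u, (⟪u, T u⟫_ℂ).re ≤ M * ‖u‖ ^ 2) {x z : E}
    (hx : x = ((1 - s : ℝ) : ℂ) • T z + (s : ℂ) • z) :
    M⁻¹ * (⟪x, T x⟫_ℂ).re * ((1 - s) + s * M⁻¹)⁻¹ ≤ (⟪x, T z⟫_ℂ).re := by
  have hc : 0 < (1 - s) * M + s := by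
    have := hs.1
    rcases hs.2.eq_or_lt with rfl | h1
    · simp
    · have : 0 < 1 - s := by linarith
      positivity
  have hR := operatorRealPart_symm T
  set R := operatorRealPart T with hRdef
  have hRT : ∀ u, (⟪u, T u⟫_ℂ).re = (⟪u, R u⟫_ℂ).re := fun u => (inner_operatorRealPart T u).symm
  simp only [hRT] at h0 h1
  set l : ℝ := ((1 - s) * M + s)⁻¹ with hl
  have e1 : M⁻¹ * (⟪x, T x⟫_ℂ).re * ((1 - s) + s * M⁻¹)⁻¹ = l * (⟪x, R x⟫_ℂ).re := by
    rw [hRT, hl, show (1 - s) + s * M⁻¹ = M⁻¹ * ((1 - s) * M + s) by field_simp, mul_inv, inv_inv]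
    field_simp
  have e2 : (⟪x, T z⟫_ℂ).re = (1 - s) * ‖T z‖ ^ 2 + s * (⟪z, R z⟫_ℂ).re := by
    have h3 : (⟪T z, T z⟫_ℂ).re = ‖T z‖ ^ 2 := inner_self_eq_norm_sq (𝕜 := ℂ) (T z)
    rw [← hRT, ← h3]
    nth_rewrite 1 [hx]
    rw [inner_add_left, inner_smul_left, inner_smul_left, Complex.conj_ofReal,
      Complex.conj_ofReal, Complex.add_re, Complex.re_ofReal_mul, Complex.re_ofReal_mul]
  have a1 : 0 ≤ ‖T z‖ ^ 2 - 2 * (l * (⟪T z, R x⟫_ℂ).re) + l ^ 2 * ‖R x‖ ^ 2 := by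
    have h := sq_nonneg ‖T z - (l : ℂ) • R x‖
    rw [norm_sub_sq (𝕜 := ℂ), norm_smul, inner_smul_right, mul_pow] at h
    simpa using h
  have a2 : 0 ≤ (⟪z, R z⟫_ℂ).re - 2 * (l * (⟪z, R x⟫_ℂ).re) + l ^ 2 * (⟪x, R x⟫_ℂ).re := by
    have h := h0 (z - (l : ℂ) • x)
    rw [inner_sub_left_map_expand hR, inner_real_smul_map, inner_real_smul_map,
      inner_map_real_smul] at h
    have h3 : (⟪x, R z⟫_ℂ).re = (⟪z, R x⟫_ℂ).re := by
      rw [← hR, ← inner_conj_symm, Complex.conj_re]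
    rw [h3] at h
    linarith
  have a3 : (⟪x, R x⟫_ℂ).re = (1 - s) * (⟪T z, R x⟫_ℂ).re + s * (⟪z, R x⟫_ℂ).re := by
    nth_rewrite 1 [hx]
    rw [inner_add_left, inner_smul_left, inner_smul_left, Complex.conj_ofReal,
      Complex.conj_ofReal, Complex.add_re, Complex.re_ofReal_mul, Complex.re_ofReal_mul]
  have a4 := norm_sq_map_le_of_symmetric hR hM h0 h1 x
  have hs1 : 0 ≤ 1 - s := by linarith [hs.2]
  have b1 := mul_nonneg hs1 a1
  have b2 := mul_nonneg hs.1 a2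
  have b4 := mul_le_mul_of_nonneg_left a4 (mul_nonneg hs1 (sq_nonneg l))
  have b5 : l ^ 2 * ((1 - s) * M + s) = l := by
    rw [hl]; field_simp
  rw [e1, e2]
  have b6 : l * (⟪x, R x⟫_ℂ).re =
      l * ((1 - s) * (⟪T z, R x⟫_ℂ).re + s * (⟪z, R x⟫_ℂ).re) := by rw [← a3]
  have b7 : l ^ 2 * ((1 - s) * M + s) * (⟪x, R x⟫_ℂ).re = l * (⟪x, R x⟫_ℂ).re := by rw [b5]
  linarith

end SesquilinearForms

/-! ### Bounds for `A^t` by integrating resolvent bounds. -/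

section MatrixPowers

open scoped InnerProductSpace

variable {n : ℕ}

theorem isUnit_det_of_inner_pos {A : Matrix (Fin n) (Fin n) ℂ}
    (h0 : ∀ u, u ≠ 0 → 0 < (⟪u, Matrix.toEuclideanCLM (𝕜 := ℂ) A u⟫_ℂ).re) : IsUnit A.det := by
  rw [isUnit_iff_ne_zero, Ne, ← Matrix.exists_mulVec_eq_zero_iff]
  rintro ⟨v, hv, hAv⟩
  have h := h0 (WithLp.toLp 2 v) (by simpa using hv)
  rw [Matrix.toEuclideanCLM_toLp, hAv] at h
  simp at h

theorem inner_toEuclideanCLM_eq_sum (A : Matrix (Fin n) (Fin n) ℂ)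
    (x y : EuclideanSpace ℂ (Fin n)) :
    ⟪y, Matrix.toEuclideanCLM (𝕜 := ℂ) A x⟫_ℂ = ∑ i, ∑ j, star (y i) * x j * A i j := by
  simp only [PiLp.inner_apply, Matrix.ofLp_toEuclideanCLM, Matrix.mulVec, dotProduct,
    RCLike.inner_apply, Finset.sum_mul]
  refine Finset.sum_congr rfl fun i _ => Finset.sum_congr rfl fun j _ => ?_
  rw [starRingEnd_apply]
  ring

/-- The integrand `((1 - s) I + s A⁻¹)⁻¹` of `matOfMeasure`. -/
noncomputable def matIntegrand (A : Matrix (Fin n) (Fin n) ℂ) (s : ℝ) :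
    Matrix (Fin n) (Fin n) ℂ :=
  ((1 - s) • (1 : Matrix (Fin n) (Fin n) ℂ) + s • A⁻¹)⁻¹

theorem toEuclideanCLM_add_smul_inv (A : Matrix (Fin n) (Fin n) ℂ) (s : ℝ)
    (x : EuclideanSpace ℂ (Fin n)) :
    Matrix.toEuclideanCLM (𝕜 := ℂ) ((1 - s) • (1 : Matrix (Fin n) (Fin n) ℂ) + s • A⁻¹) x =
      ((1 - s : ℝ) : ℂ) • x + (s : ℂ) • Matrix.toEuclideanCLM (𝕜 := ℂ) A⁻¹ x := by
  rw [RCLike.real_smul_eq_coe_smul (K := ℂ) (1 - s), RCLike.real_smul_eq_coe_smul (K := ℂ) s,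
    map_add, map_smul, map_smul, map_one]
  rfl

theorem toEuclideanCLM_mul_apply (A B : Matrix (Fin n) (Fin n) ℂ)
    (x : EuclideanSpace ℂ (Fin n)) :
    Matrix.toEuclideanCLM (𝕜 := ℂ) (A * B) x =
      Matrix.toEuclideanCLM (𝕜 := ℂ) A (Matrix.toEuclideanCLM (𝕜 := ℂ) B x) := by
  rw [map_mul]
  rfl

theorem toEuclideanCLM_mul_inv_cancel {A : Matrix (Fin n) (Fin n) ℂ} (hA : IsUnit A.det)
    (x : EuclideanSpace ℂ (Fin n)) :
    Matrix.toEuclideanCLM (𝕜 := ℂ) A (Matrix.toEuclideanCLM (𝕜 := ℂ) A⁻¹ x) = x := by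
  rw [← toEuclideanCLM_mul_apply, Matrix.mul_nonsing_inv _ hA, map_one]
  rfl

/-- A kernel vector `v` corresponds to `x = 0`, `z = A⁻¹ v` in `norm_resolvent_le`, which forces `v
= A z = 0`. -/
theorem isUnit_det_resolvent {A : Matrix (Fin n) (Fin n) ℂ} (hA : IsUnit A.det) {N : ℝ}
    (hN : 0 < N) (h : ∀ u, ‖Matrix.toEuclideanCLM (𝕜 := ℂ) A u‖ ^ 2 ≤
      N * (⟪u, Matrix.toEuclideanCLM (𝕜 := ℂ) A u⟫_ℂ).re) {s : ℝ} (hs : s ∈ Set.Icc (0 : ℝ) 1) :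
    IsUnit ((1 - s) • (1 : Matrix (Fin n) (Fin n) ℂ) + s • A⁻¹).det := by
  rw [isUnit_iff_ne_zero, Ne, ← Matrix.exists_mulVec_eq_zero_iff]
  rintro ⟨v, hv, hAv⟩
  have h1 := toEuclideanCLM_add_smul_inv A s (WithLp.toLp 2 v)
  rw [Matrix.toEuclideanCLM_toLp, hAv] at h1
  have h2 := norm_resolvent_le hN hs h (x := 0)
    (z := Matrix.toEuclideanCLM (𝕜 := ℂ) A⁻¹ (WithLp.toLp 2 v))
    (by rw [toEuclideanCLM_mul_inv_cancel hA]; exact h1)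
  rw [toEuclideanCLM_mul_inv_cancel hA, norm_zero, zero_mul, norm_le_zero_iff] at h2
  exact hv (by simpa using h2)

theorem exists_resolvent_decomposition {A : Matrix (Fin n) (Fin n) ℂ} (hA : IsUnit A.det) {N : ℝ}
    (hN : 0 < N) (h : ∀ u, ‖Matrix.toEuclideanCLM (𝕜 := ℂ) A u‖ ^ 2 ≤
      N * (⟪u, Matrix.toEuclideanCLM (𝕜 := ℂ) A u⟫_ℂ).re) {s : ℝ} (hs : s ∈ Set.Icc (0 : ℝ) 1)
    (x : EuclideanSpace ℂ (Fin n)) :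
    ∃ z, Matrix.toEuclideanCLM (𝕜 := ℂ) (matIntegrand A s) x =
        Matrix.toEuclideanCLM (𝕜 := ℂ) A z ∧
      x = ((1 - s : ℝ) : ℂ) • Matrix.toEuclideanCLM (𝕜 := ℂ) A z + (s : ℂ) • z := by
  refine ⟨Matrix.toEuclideanCLM (𝕜 := ℂ) A⁻¹
    (Matrix.toEuclideanCLM (𝕜 := ℂ) (matIntegrand A s) x), ?_, ?_⟩
  · rw [toEuclideanCLM_mul_inv_cancel hA]
  · rw [toEuclideanCLM_mul_inv_cancel hA, ← toEuclideanCLM_add_smul_inv]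
    exact (toEuclideanCLM_mul_inv_cancel (isUnit_det_resolvent hA hN h hs) x).symm

theorem integrableOn_matIntegrand {A : Matrix (Fin n) (Fin n) ℂ} (hA : IsUnit A.det) {N : ℝ}
    (hN : 0 < N) (h : ∀ u, ‖Matrix.toEuclideanCLM (𝕜 := ℂ) A u‖ ^ 2 ≤
      N * (⟪u, Matrix.toEuclideanCLM (𝕜 := ℂ) A u⟫_ℂ).re)
    (ν : MeasureTheory.Measure ℝ) [MeasureTheory.IsFiniteMeasure ν] (i j : Fin n) :
    MeasureTheory.IntegrableOn (fun s => matIntegrand A s i j) (Set.Icc 0 1) ν := by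
  have hc : Continuous fun s : ℝ => (1 - s) • (1 : Matrix (Fin n) (Fin n) ℂ) + s • A⁻¹ := by
    fun_prop
  -- The adjugate formula makes each entry a quotient of continuous functions of `s`, with
  -- nonvanishing denominator on `[0, 1]`.
  have he : ∀ s, matIntegrand A s i j =
      (((1 - s) • (1 : Matrix (Fin n) (Fin n) ℂ) + s • A⁻¹).det)⁻¹ *
        ((1 - s) • (1 : Matrix (Fin n) (Fin n) ℂ) + s • A⁻¹).adjugate i j := fun s => by
    rw [matIntegrand, Matrix.inv_def ((1 - s) • (1 : Matrix (Fin n) (Fin n) ℂ) + s • A⁻¹),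
      Ring.inverse_eq_inv', Matrix.smul_apply, smul_eq_mul]
  simp only [he]
  exact ContinuousOn.integrableOn_compact isCompact_Icc <|
    (hc.matrix_det.continuousOn.inv₀ fun s hs => (isUnit_det_resolvent hA hN h hs).ne_zero).mul
      (hc.matrix_adjugate.matrix_elem i j).continuousOn

theorem inner_matOfMeasure {A : Matrix (Fin n) (Fin n) ℂ} {ν : MeasureTheory.Measure ℝ}
    (hi : ∀ i j, MeasureTheory.IntegrableOn (fun s => matIntegrand A s i j) (Set.Icc 0 1) ν)
    (x y : EuclideanSpace ℂ (Fin n)) :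
    ⟪y, Matrix.toEuclideanCLM (𝕜 := ℂ) (matOfMeasure ν A) x⟫_ℂ =
      ∫ s in Set.Icc 0 1, ⟪y, Matrix.toEuclideanCLM (𝕜 := ℂ) (matIntegrand A s) x⟫_ℂ ∂ν := by
  simp only [inner_toEuclideanCLM_eq_sum]
  rw [MeasureTheory.integral_finsetSum _ fun i _ =>
    MeasureTheory.integrable_finsetSum _ fun j _ => (hi i j).const_mul _]
  refine Finset.sum_congr rfl fun i _ => ?_
  rw [MeasureTheory.integral_finsetSum _ fun j _ => (hi i j).const_mul _]
  refine Finset.sum_congr rfl fun j _ => ?_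
  rw [MeasureTheory.integral_const_mul]
  rfl

theorem integrableOn_inner_matIntegrand {A : Matrix (Fin n) (Fin n) ℂ}
    {ν : MeasureTheory.Measure ℝ}
    (hi : ∀ i j, MeasureTheory.IntegrableOn (fun s => matIntegrand A s i j) (Set.Icc 0 1) ν)
    (x y : EuclideanSpace ℂ (Fin n)) :
    MeasureTheory.IntegrableOn
      (fun s => ⟪y, Matrix.toEuclideanCLM (𝕜 := ℂ) (matIntegrand A s) x⟫_ℂ) (Set.Icc 0 1) ν := by
  simp only [inner_toEuclideanCLM_eq_sum]
  exact MeasureTheory.integrable_finsetSum _ fun i _ =>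
    MeasureTheory.integrable_finsetSum _ fun j _ => (hi i j).const_mul _

theorem integrableOn_weighted_harmonic (ν : MeasureTheory.Measure ℝ)
    [MeasureTheory.IsFiniteMeasure ν] {x : ℝ} (hx : 0 < x) :
    MeasureTheory.IntegrableOn (fun s : ℝ => ((1 - s) + s * x⁻¹)⁻¹) (Set.Icc 0 1) ν := by
  refine ContinuousOn.integrableOn_compact isCompact_Icc (ContinuousOn.inv₀ (by fun_prop) ?_)
  intro s hs
  have := hs.1
  rcases hs.2.eq_or_lt with rfl | h1
  · simpa using hx.ne'
  · have : 0 < 1 - s := by linarith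
    positivity

theorem norm_inner_matRpow_le {A : Matrix (Fin n) (Fin n) ℂ} (hA : IsUnit A.det) {N : ℝ}
    (hN : 0 < N) (h : ∀ u, ‖Matrix.toEuclideanCLM (𝕜 := ℂ) A u‖ ^ 2 ≤
      N * (⟪u, Matrix.toEuclideanCLM (𝕜 := ℂ) A u⟫_ℂ).re) {t : ℝ} (ht : t ∈ Set.Ioo (0 : ℝ) 1)
    (x y : EuclideanSpace ℂ (Fin n)) :
    ‖⟪y, Matrix.toEuclideanCLM (𝕜 := ℂ) (matRpow A t) x⟫_ℂ‖ ≤ ‖y‖ * ‖x‖ * N ^ t := by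
  have := isProbabilityMeasure_rpowMeasure ht
  rw [matRpow, inner_matOfMeasure (integrableOn_matIntegrand hA hN h _),
    rpow_eq_integral_rpowMeasure ht hN, ← MeasureTheory.integral_const_mul]
  refine MeasureTheory.norm_integral_le_of_norm_le
    ((integrableOn_weighted_harmonic _ hN).const_mul _) ?_
  refine (MeasureTheory.ae_restrict_iff' measurableSet_Icc).2 (.of_forall fun s hs => ?_)
  obtain ⟨z, hz, hx⟩ := exists_resolvent_decomposition hA hN h hs x
  rw [hz, mul_assoc]
  exact (norm_inner_le_norm _ _).trans
    (mul_le_mul_of_nonneg_left (norm_resolvent_le hN hs h hx) (norm_nonneg _))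

/-- Here `N` serves only invertibility and integrability of the resolvents; the bound depends on
`M`, which may be any upper bound of `Re A`. This freedom allows one constant for two matrices. -/
theorem le_inner_matRpow {A : Matrix (Fin n) (Fin n) ℂ} (hA : IsUnit A.det) {N M : ℝ}
    (hN : 0 < N) (h : ∀ u, ‖Matrix.toEuclideanCLM (𝕜 := ℂ) A u‖ ^ 2 ≤
      N * (⟪u, Matrix.toEuclideanCLM (𝕜 := ℂ) A u⟫_ℂ).re) (hM : 0 < M)
    (h0 : ∀ u, 0 ≤ (⟪u, Matrix.toEuclideanCLM (𝕜 := ℂ) A u⟫_ℂ).re)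
    (h1 : ∀ u, (⟪u, Matrix.toEuclideanCLM (𝕜 := ℂ) A u⟫_ℂ).re ≤ M * ‖u‖ ^ 2)
    {t : ℝ} (ht : t ∈ Set.Ioo (0 : ℝ) 1) (x : EuclideanSpace ℂ (Fin n)) :
    M⁻¹ * (⟪x, Matrix.toEuclideanCLM (𝕜 := ℂ) A x⟫_ℂ).re * M ^ t ≤
      (⟪x, Matrix.toEuclideanCLM (𝕜 := ℂ) (matRpow A t) x⟫_ℂ).re := by
  have := isProbabilityMeasure_rpowMeasure ht
  have hi := integrableOn_matIntegrand hA hN h (rpowMeasure t)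
  have hi' := integrableOn_inner_matIntegrand hi x x
  have hre : (∫ s in Set.Icc 0 1, ⟪x, Matrix.toEuclideanCLM (𝕜 := ℂ) (matIntegrand A s) x⟫_ℂ
      ∂(rpowMeasure t)).re = ∫ s in Set.Icc 0 1,
        (⟪x, Matrix.toEuclideanCLM (𝕜 := ℂ) (matIntegrand A s) x⟫_ℂ).re ∂(rpowMeasure t) :=
    (integral_re hi').symm
  rw [matRpow, inner_matOfMeasure hi, hre, rpow_eq_integral_rpowMeasure ht hM,
    ← MeasureTheory.integral_const_mul]
  refine MeasureTheory.setIntegral_mono_on ((integrableOn_weighted_harmonic _ hM).const_mul _)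
    hi'.re measurableSet_Icc fun s hs => ?_
  obtain ⟨z, hz, hx⟩ := exists_resolvent_decomposition hA hN h hs x
  rw [hz]
  exact inner_resolvent_ge hM hs h0 h1 hx

end MatrixPowers

/-! ### The `q`-numerical radius against the ordinary numerical radius. -/

section QNumericalRadius

open scoped InnerProductSpace

variable {n : ℕ}

theorem qNumericalRadius_le {q : ℂ} {A : Matrix (Fin n) (Fin n) ℂ} {C : ℝ} (hC : 0 ≤ C)
    (h : ∀ x y : EuclideanSpace ℂ (Fin n), ‖x‖ = 1 → ‖y‖ = 1 →
      ‖⟪y, Matrix.toEuclideanCLM (𝕜 := ℂ) A x⟫_ℂ‖ ≤ C) : qNumericalRadius q A ≤ C := by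
  refine Real.sSup_le ?_ hC
  rintro _ ⟨_, ⟨x, y, hx, hy, -, rfl⟩, rfl⟩
  exact h x y hx hy

theorem qNumericalRadius_nonneg (q : ℂ) (A : Matrix (Fin n) (Fin n) ℂ) :
    0 ≤ qNumericalRadius q A := by
  refine Real.sSup_nonneg ?_
  rintro _ ⟨_, _, rfl⟩
  exact norm_nonneg _

theorem le_qNumericalRadius {q : ℂ} (A : Matrix (Fin n) (Fin n) ℂ)
    {x y : EuclideanSpace ℂ (Fin n)} (hx : ‖x‖ = 1) (hy : ‖y‖ = 1) (hq : ⟪y, x⟫_ℂ = q) :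
    ‖⟪y, Matrix.toEuclideanCLM (𝕜 := ℂ) A x⟫_ℂ‖ ≤ qNumericalRadius q A := by
  refine le_csSup ⟨‖Matrix.toEuclideanCLM (𝕜 := ℂ) A‖, ?_⟩ ⟨_, ⟨x, y, hx, hy, hq, rfl⟩, rfl⟩
  rintro _ ⟨_, ⟨x, y, hx, hy, -, rfl⟩, rfl⟩
  refine (norm_inner_le_norm _ _).trans ?_
  rw [hy, one_mul]
  simpa [hx] using (Matrix.toEuclideanCLM (𝕜 := ℂ) A).le_opNorm x

theorem qNumericalRadius_eq_zero {q : ℂ}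
    (h : ¬∃ x y : EuclideanSpace ℂ (Fin n), ‖x‖ = 1 ∧ ‖y‖ = 1 ∧ ⟪y, x⟫_ℂ = q)
    (A : Matrix (Fin n) (Fin n) ℂ) : qNumericalRadius q A = 0 := by
  have : qNumericalRange q A = ∅ := by
    refine Set.eq_empty_of_forall_notMem ?_
    rintro _ ⟨x, y, hx, hy, hxy, -⟩
    exact h ⟨x, y, hx, hy, hxy⟩
  rw [qNumericalRadius, this, Set.image_empty, Real.sSup_empty]

/-- `|q| w(A) ≤ w_q(A)`, provided that the `q`-numerical range is not empty. -/
theorem norm_mul_norm_inner_le_qNumericalRadius {q : ℂ} (hq : ‖q‖ ≤ 1)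
    (h : ∃ x y : EuclideanSpace ℂ (Fin n), ‖x‖ = 1 ∧ ‖y‖ = 1 ∧ ⟪y, x⟫_ℂ = q)
    (A : Matrix (Fin n) (Fin n) ℂ) {x : EuclideanSpace ℂ (Fin n)} (hx : ‖x‖ = 1) :
    ‖q‖ * ‖⟪x, Matrix.toEuclideanCLM (𝕜 := ℂ) A x⟫_ℂ‖ ≤ qNumericalRadius q A := by
  have hxx : ⟪x, x⟫_ℂ = 1 := by rw [inner_self_eq_norm_sq_to_K, hx]; simp
  by_cases hz : ∃ z : EuclideanSpace ℂ (Fin n), ‖z‖ = 1 ∧ ⟪x, z⟫_ℂ = 0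
  · obtain ⟨z, hz1, hxz⟩ := hz
    have hzx : ⟪z, x⟫_ℂ = 0 := inner_eq_zero_symm.1 hxz
    -- The vectors `y = q̄ x + c z` with `c = ±√(1 - |q|²)` are both admissible; adding the two
    -- values cancels the `z` term.
    have key : ∀ c : ℝ, c ^ 2 = 1 - ‖q‖ ^ 2 →
        ‖q * ⟪x, Matrix.toEuclideanCLM (𝕜 := ℂ) A x⟫_ℂ +
          c * ⟪z, Matrix.toEuclideanCLM (𝕜 := ℂ) A x⟫_ℂ‖ ≤ qNumericalRadius q A := by
      intro c hc
      have hy : ‖(starRingEnd ℂ q) • x + (c : ℂ) • z‖ = 1 := by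
        rw [← sq_eq_sq₀ (norm_nonneg _) zero_le_one, norm_add_sq (𝕜 := ℂ), inner_smul_left,
          inner_smul_right, hxz, norm_smul, norm_smul, hx, hz1, RCLike.norm_conj]
        simp [hc]
      have h1 := le_qNumericalRadius A hx hy (q := q) (by
        rw [inner_add_left, inner_smul_left, inner_smul_left, hxx, hzx]; simp)
      rwa [inner_add_left, inner_smul_left, inner_smul_left, Complex.conj_conj,
        Complex.conj_ofReal] at h1
    have h0 : 0 ≤ 1 - ‖q‖ ^ 2 := by nlinarith [norm_nonneg q]
    have k1 := key (Real.sqrt (1 - ‖q‖ ^ 2)) (Real.sq_sqrt h0)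
    have k2 := key (-Real.sqrt (1 - ‖q‖ ^ 2)) (by rw [neg_sq, Real.sq_sqrt h0])
    have k3 := (norm_add_le _ _).trans (add_le_add k1 k2)
    rw [Complex.ofReal_neg, neg_mul, add_add_add_comm, add_neg_cancel, add_zero, ← two_mul,
      norm_mul, norm_mul] at k3
    norm_num at k3
    linarith
  -- No unit vector is orthogonal to `x`, so the space is a line; nonemptiness of the range then
  -- forces `|q| = 1`.
  · have hspan : ∀ y : EuclideanSpace ℂ (Fin n), y = ⟪x, y⟫_ℂ • x := by
      intro y
      by_contra hne
      have hne' : y - ⟪x, y⟫_ℂ • x ≠ 0 := sub_ne_zero.2 hne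
      refine hz ⟨((‖y - ⟪x, y⟫_ℂ • x‖⁻¹ : ℝ) : ℂ) • (y - ⟪x, y⟫_ℂ • x), ?_, ?_⟩
      · rw [norm_smul, Complex.norm_real, norm_inv, norm_norm,
          inv_mul_cancel₀ (norm_ne_zero_iff.2 hne')]
      · rw [inner_smul_right, inner_sub_right, inner_smul_right, hxx]
        simp
    obtain ⟨x', y', hx', hy', hxy⟩ := h
    have e : ∀ v : EuclideanSpace ℂ (Fin n), ‖v‖ = 1 → ‖⟪x, v⟫_ℂ‖ = 1 := by
      intro v hv
      have h1 := congrArg norm (hspan v)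
      rwa [norm_smul, hx, mul_one, hv, eq_comm] at h1
    have hq1 : ‖q‖ = 1 := by
      rw [← hxy, hspan x', hspan y', inner_smul_left, inner_smul_right, hxx, mul_one, norm_mul,
        RCLike.norm_conj, e x' hx', e y' hy', one_mul]
    have h1 := le_qNumericalRadius A (q := q) hx
      (y := (starRingEnd ℂ q) • x) (by rw [norm_smul, RCLike.norm_conj, hq1, hx, one_mul])
      (by rw [inner_smul_left, hxx]; simp)
    rwa [inner_smul_left, Complex.conj_conj, norm_mul] at h1

end QNumericalRadius

/-! ### Sectorial matrices: constants in terms of `α`. -/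

section Sectorial

open scoped InnerProductSpace

variable {n : ℕ}

theorem IsSectorial.inner_mem_sector {α : ℝ} {A : Matrix (Fin n) (Fin n) ℂ}
    (hA : IsSectorial α A) {u : EuclideanSpace ℂ (Fin n)} (hu : u ≠ 0) :
    ⟪u, Matrix.toEuclideanCLM (𝕜 := ℂ) A u⟫_ℂ ∈ sector α := by
  have hu' : 0 < ‖u‖ := norm_pos_iff.2 hu
  have h := hA ⟨((‖u‖⁻¹ : ℝ) : ℂ) • u, by
    rw [norm_smul, Complex.norm_real, norm_inv, norm_norm, inv_mul_cancel₀ hu'.ne'], rfl⟩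
  rw [map_smul, inner_smul_left, inner_smul_right, Complex.conj_ofReal, ← mul_assoc,
    ← Complex.ofReal_mul] at h
  have hc : 0 < ‖u‖⁻¹ * ‖u‖⁻¹ := by positivity
  obtain ⟨h1, h2⟩ := h
  rw [Complex.re_ofReal_mul] at h1 h2
  rw [Complex.im_ofReal_mul, abs_mul, abs_of_pos hc] at h2
  refine ⟨pos_of_mul_pos_right h1 hc.le, le_of_mul_le_mul_left ?_ hc⟩
  linarith

theorem IsSectorial.inner_re_pos {α : ℝ} {A : Matrix (Fin n) (Fin n) ℂ}
    (hA : IsSectorial α A) (u : EuclideanSpace ℂ (Fin n)) (hu : u ≠ 0) :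
    0 < (⟪u, Matrix.toEuclideanCLM (𝕜 := ℂ) A u⟫_ℂ).re :=
  (hA.inner_mem_sector hu).1

theorem IsSectorial.inner_re_nonneg {α : ℝ} {A : Matrix (Fin n) (Fin n) ℂ}
    (hA : IsSectorial α A) (u : EuclideanSpace ℂ (Fin n)) :
    0 ≤ (⟪u, Matrix.toEuclideanCLM (𝕜 := ℂ) A u⟫_ℂ).re := by
  rcases eq_or_ne u 0 with rfl | hu
  · simp
  · exact (hA.inner_re_pos u hu).le

theorem IsSectorial.abs_inner_im_le {α : ℝ} {A : Matrix (Fin n) (Fin n) ℂ}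
    (hA : IsSectorial α A) (u : EuclideanSpace ℂ (Fin n)) :
    |(⟪u, Matrix.toEuclideanCLM (𝕜 := ℂ) A u⟫_ℂ).im| ≤
      Real.tan α * (⟪u, Matrix.toEuclideanCLM (𝕜 := ℂ) A u⟫_ℂ).re := by
  rcases eq_or_ne u 0 with rfl | hu
  · simp
  · exact (hA.inner_mem_sector hu).2

theorem IsSectorial.add {α : ℝ} {A B : Matrix (Fin n) (Fin n) ℂ}
    (hA : IsSectorial α A) (hB : IsSectorial α B) : IsSectorial α (A + B) := by
  rintro _ ⟨x, hx, rfl⟩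
  obtain ⟨a1, a2⟩ := hA ⟨x, hx, rfl⟩
  obtain ⟨b1, b2⟩ := hB ⟨x, hx, rfl⟩
  rw [map_add, add_apply, inner_add_right]
  refine ⟨by rw [Complex.add_re]; exact add_pos a1 b1, ?_⟩
  rw [Complex.add_re, Complex.add_im, mul_add]
  exact (abs_add_le _ _).trans (add_le_add a2 b2)

theorem IsSectorial.exists_isMax_inner_re {α : ℝ} {A : Matrix (Fin n) (Fin n) ℂ}
    (hA : IsSectorial α A) (hne : ∃ x : EuclideanSpace ℂ (Fin n), ‖x‖ = 1) :
    ∃ M : ℝ, 0 < M ∧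
      (∀ u, (⟪u, Matrix.toEuclideanCLM (𝕜 := ℂ) A u⟫_ℂ).re ≤ M * ‖u‖ ^ 2) ∧
      ∃ x : EuclideanSpace ℂ (Fin n), ‖x‖ = 1 ∧
        (⟪x, Matrix.toEuclideanCLM (𝕜 := ℂ) A x⟫_ℂ).re = M := by
  obtain ⟨x₁, hx₁⟩ := hne
  have hcont : Continuous fun u : EuclideanSpace ℂ (Fin n) =>
      (⟪u, Matrix.toEuclideanCLM (𝕜 := ℂ) A u⟫_ℂ).re := by fun_prop
  obtain ⟨x, hx, hmax⟩ := (isCompact_sphere (0 : EuclideanSpace ℂ (Fin n)) 1).exists_isMaxOn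
    ⟨x₁, by simpa using hx₁⟩ hcont.continuousOn
  have hx : ‖x‖ = 1 := by simpa using hx
  refine ⟨_, hA.inner_re_pos x (norm_ne_zero_iff.1 (by rw [hx]; exact one_ne_zero)), ?_, x, hx,
    rfl⟩
  intro u
  rcases eq_or_ne u 0 with rfl | hu
  · simp
  have hu' : 0 < ‖u‖ := norm_pos_iff.2 hu
  have h : (⟪((‖u‖⁻¹ : ℝ) : ℂ) • u, Matrix.toEuclideanCLM (𝕜 := ℂ) A
      (((‖u‖⁻¹ : ℝ) : ℂ) • u)⟫_ℂ).re ≤ (⟪x, Matrix.toEuclideanCLM (𝕜 := ℂ) A x⟫_ℂ).re :=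
    hmax (by
      rw [mem_sphere_zero_iff_norm, norm_smul, Complex.norm_real, norm_inv, norm_norm,
        inv_mul_cancel₀ hu'.ne'])
  rw [inner_real_smul_map, inner_map_real_smul, inv_mul_le_iff₀ hu', inv_mul_le_iff₀ hu'] at h
  linarith

variable {α : ℝ}

theorem one_add_tan_sq_eq (hα : α ∈ Set.Ico 0 (Real.pi / 2)) :
    1 + Real.tan α ^ 2 = (1 / Real.cos α) ^ 2 := by
  have hc : Real.cos α ≠ 0 :=
    (Real.cos_pos_of_mem_Ioo ⟨by linarith [hα.1, Real.pi_pos], hα.2⟩).ne'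
  rw [one_div, inv_pow, ← Real.inv_one_add_tan_sq hc, inv_inv]

theorem IsSectorial.norm_sq_le (hα : α ∈ Set.Ico 0 (Real.pi / 2))
    {A : Matrix (Fin n) (Fin n) ℂ} (hA : IsSectorial α A) {M : ℝ} (hM : 0 < M)
    (h1 : ∀ u, (⟪u, Matrix.toEuclideanCLM (𝕜 := ℂ) A u⟫_ℂ).re ≤ M * ‖u‖ ^ 2)
    (u : EuclideanSpace ℂ (Fin n)) :
    ‖Matrix.toEuclideanCLM (𝕜 := ℂ) A u‖ ^ 2 ≤
      (1 / Real.cos α) ^ 2 * M * (⟪u, Matrix.toEuclideanCLM (𝕜 := ℂ) A u⟫_ℂ).re := by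
  rw [← one_add_tan_sq_eq hα]
  exact norm_sq_map_le_of_sectorial hM
    (Real.tan_nonneg_of_nonneg_of_le_pi_div_two hα.1 hα.2.le) hA.inner_re_pos h1
    hA.abs_inner_im_le u

theorem one_le_one_div_cos (hα : α ∈ Set.Ico 0 (Real.pi / 2)) : 1 ≤ 1 / Real.cos α := by
  rw [le_div_iff₀ (Real.cos_pos_of_mem_Ioo ⟨by linarith [hα.1, Real.pi_pos], hα.2⟩), one_mul]
  exact Real.cos_le_one α

/-- Used with `b = sec α`. The argument reaches `b²`; the third power is slack. -/
theorem mul_rpow_le_of_one_le {b M t : ℝ} (hb : 1 ≤ b) (hM : 0 < M) (ht : t ∈ Set.Ioo (0 : ℝ) 1) :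
    (b ^ 2 * M) ^ t ≤ b ^ 3 * M ^ t := by
  have hb0 : 0 < b := by linarith
  rw [Real.mul_rpow (by positivity) hM.le]
  gcongr
  calc (b ^ 2) ^ t ≤ (b ^ 2) ^ (1 : ℝ) :=
        Real.rpow_le_rpow_of_exponent_le (one_le_pow₀ hb) ht.2.le
    _ = b ^ 2 := Real.rpow_one _
    _ ≤ b ^ 3 := pow_le_pow_right₀ hb (by norm_num)

theorem IsSectorial.norm_inner_matRpow_le (hα : α ∈ Set.Ico 0 (Real.pi / 2))
    {A : Matrix (Fin n) (Fin n) ℂ} (hA : IsSectorial α A) {M : ℝ} (hM : 0 < M)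
    (h1 : ∀ u, (⟪u, Matrix.toEuclideanCLM (𝕜 := ℂ) A u⟫_ℂ).re ≤ M * ‖u‖ ^ 2)
    {t : ℝ} (ht : t ∈ Set.Ioo (0 : ℝ) 1) {x y : EuclideanSpace ℂ (Fin n)}
    (hx : ‖x‖ = 1) (hy : ‖y‖ = 1) :
    ‖⟪y, Matrix.toEuclideanCLM (𝕜 := ℂ) (matRpow A t) x⟫_ℂ‖ ≤ (1 / Real.cos α) ^ 3 * M ^ t := by
  have hb := one_le_one_div_cos hα
  have h := _root_.norm_inner_matRpow_le (isUnit_det_of_inner_pos hA.inner_re_pos)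
    (by positivity) (hA.norm_sq_le hα hM h1) ht x y
  rw [hx, hy, one_mul, one_mul] at h
  exact h.trans (mul_rpow_le_of_one_le hb hM ht)

theorem IsSectorial.le_inner_matRpow (hα : α ∈ Set.Ico 0 (Real.pi / 2))
    {A : Matrix (Fin n) (Fin n) ℂ} (hA : IsSectorial α A) {M : ℝ} (hM : 0 < M)
    (h1 : ∀ u, (⟪u, Matrix.toEuclideanCLM (𝕜 := ℂ) A u⟫_ℂ).re ≤ M * ‖u‖ ^ 2)
    {t : ℝ} (ht : t ∈ Set.Ioo (0 : ℝ) 1) (x : EuclideanSpace ℂ (Fin n)) :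
    M⁻¹ * (⟪x, Matrix.toEuclideanCLM (𝕜 := ℂ) A x⟫_ℂ).re * M ^ t ≤
      (⟪x, Matrix.toEuclideanCLM (𝕜 := ℂ) (matRpow A t) x⟫_ℂ).re := by
  have hb := one_le_one_div_cos hα
  exact _root_.le_inner_matRpow (isUnit_det_of_inner_pos hA.inner_re_pos) (by positivity)
    (hA.norm_sq_le hα hM h1) hM hA.inner_re_nonneg h1 ht x

theorem IsSectorial.qNumericalRadius_le (hα : α ∈ Set.Ico 0 (Real.pi / 2))
    {A : Matrix (Fin n) (Fin n) ℂ} (hA : IsSectorial α A) {M : ℝ} (hM : 0 < M)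
    (h1 : ∀ u, (⟪u, Matrix.toEuclideanCLM (𝕜 := ℂ) A u⟫_ℂ).re ≤ M * ‖u‖ ^ 2) (q : ℂ) :
    qNumericalRadius q A ≤ 1 / Real.cos α * M := by
  have hb := one_le_one_div_cos hα
  refine _root_.qNumericalRadius_le (by positivity) fun x y hx hy => ?_
  refine (norm_inner_le_norm _ _).trans ?_
  rw [hy, one_mul]
  refine (sq_le_sq₀ (norm_nonneg _) (by positivity)).1 ?_
  refine (hA.norm_sq_le hα hM h1 x).trans ?_
  have h2 := h1 x
  rw [hx, one_pow, mul_one] at h2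
  calc _ ≤ (1 / Real.cos α) ^ 2 * M * M := by gcongr
    _ = _ := by ring

theorem norm_mul_inner_re_le_qNumericalRadius {q : ℂ} (hq : ‖q‖ ≤ 1)
    (h : ∃ x y : EuclideanSpace ℂ (Fin n), ‖x‖ = 1 ∧ ‖y‖ = 1 ∧ ⟪y, x⟫_ℂ = q)
    (A : Matrix (Fin n) (Fin n) ℂ) {x : EuclideanSpace ℂ (Fin n)} (hx : ‖x‖ = 1) :
    ‖q‖ * (⟪x, Matrix.toEuclideanCLM (𝕜 := ℂ) A x⟫_ℂ).re ≤ qNumericalRadius q A :=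
  (mul_le_mul_of_nonneg_left (Complex.re_le_norm _) (norm_nonneg q)).trans
    (norm_mul_norm_inner_le_qNumericalRadius hq h A hx)

/-- A factor `r ≤ 1` moves inside the power because `r ≤ r^t`. It is used with `r = |q|` and with `r
= cos α`. -/
theorem mul_rpow_le_rpow {r M W t : ℝ} (hr0 : 0 ≤ r) (hr1 : r ≤ 1) (hM : 0 ≤ M)
    (ht : t ∈ Set.Ioo (0 : ℝ) 1) (h : r * M ≤ W) : r * M ^ t ≤ W ^ t := by
  have h1 : r ≤ r ^ t := by
    simpa using Real.rpow_le_rpow_of_exponent_ge' hr0 hr1 ht.1.le ht.2.le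
  calc r * M ^ t ≤ r ^ t * M ^ t := by gcongr
    _ = (r * M) ^ t := (Real.mul_rpow hr0 hM).symm
    _ ≤ W ^ t := Real.rpow_le_rpow (by positivity) h ht.1.le

end Sectorial

/-! ### The three inequalities. -/

theorem mainTheorem10 {n : ℕ} {α : ℝ} (hα : α ∈ Set.Ico 0 (Real.pi / 2))
    {q : ℂ} (hq : ‖q‖ ≤ 1) {t : ℝ} (ht : t ∈ Set.Ioo (0 : ℝ) 1)
    (A B : Matrix (Fin n) (Fin n) ℂ) (hA : IsSectorial α A) (hB : IsSectorial α B) :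
    (‖q‖ ^ 2 * Real.cos α * qNumericalRadius q A ^ t ≤ ‖q‖ * qNumericalRadius q (matRpow A t) ∧
      ‖q‖ * qNumericalRadius q (matRpow A t) ≤
        (1 / Real.cos α) ^ 3 * qNumericalRadius q A ^ t) ∧
    (∀ γ ∈ Set.Ioo (0 : ℝ) 1,
      ‖q‖ * qNumericalRadius q ((1 - γ) • matRpow A t + γ • matRpow B t) ≤
        (1 / Real.cos α) ^ 3 *
          ((1 - γ) * qNumericalRadius q A + γ * qNumericalRadius q B) ^ t) ∧
    ‖q‖ * qNumericalRadius q (matRpow (A + B) t) ≤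
      (1 / Real.cos α) ^ 3 * qNumericalRadius q (matRpow A t + matRpow B t) := by
  have hb := one_le_one_div_cos hα
  have ht0 := ht.1
  have hq0 := norm_nonneg q
  by_cases hne : ∃ x y : EuclideanSpace ℂ (Fin n), ‖x‖ = 1 ∧ ‖y‖ = 1 ∧ inner ℂ y x = q
  swap
  -- With no admissible pair every radius is `0`, and `0^t = 0` since `t ≠ 0`.
  · simp [qNumericalRadius_eq_zero hne, Real.zero_rpow ht0.ne']
  have hunit : ∃ x : EuclideanSpace ℂ (Fin n), ‖x‖ = 1 :=
    let ⟨x, _, hx, _⟩ := hne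
    ⟨x, hx⟩
  obtain ⟨M, hM, hAM, x, hx, hxM⟩ := hA.exists_isMax_inner_re hunit
  obtain ⟨N, hN, hBN, y, hy, hyN⟩ := hB.exists_isMax_inner_re hunit
  have hMq : ‖q‖ * M ≤ qNumericalRadius q A := by
    rw [← hxM]; exact norm_mul_inner_re_le_qNumericalRadius hq hne A hx
  have hNq : ‖q‖ * N ≤ qNumericalRadius q B := by
    rw [← hyN]; exact norm_mul_inner_re_le_qNumericalRadius hq hne B hy
  refine ⟨⟨?_, ?_⟩, ?_, ?_⟩
  -- At the maximizer `x` the lower bound `M^(t-1) Re ⟨Ax, x⟩` equals `M^t`.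
  · have h1 := hA.le_inner_matRpow hα hM hAM ht x
    rw [hxM, inv_mul_cancel₀ hM.ne', one_mul] at h1
    have h2 := norm_mul_inner_re_le_qNumericalRadius hq hne (matRpow A t) hx
    have hcos : 0 < Real.cos α :=
      Real.cos_pos_of_mem_Ioo ⟨by linarith [hα.1, Real.pi_pos], hα.2⟩
    have h3 : Real.cos α * qNumericalRadius q A ^ t ≤ M ^ t := by
      refine mul_rpow_le_rpow hcos.le (Real.cos_le_one α) (qNumericalRadius_nonneg q A) ht ?_
      calc _ ≤ Real.cos α * (1 / Real.cos α * M) := by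
            gcongr; exact hA.qNumericalRadius_le hα hM hAM q
        _ = M := by field_simp
    calc ‖q‖ ^ 2 * Real.cos α * qNumericalRadius q A ^ t
        = ‖q‖ * (‖q‖ * (Real.cos α * qNumericalRadius q A ^ t)) := by ring
      _ ≤ ‖q‖ * (‖q‖ * (inner ℂ x (Matrix.toEuclideanCLM (𝕜 := ℂ) (matRpow A t) x)).re) := by
          gcongr; exact h3.trans h1
      _ ≤ _ := by gcongr
  · have h1 : qNumericalRadius q (matRpow A t) ≤ (1 / Real.cos α) ^ 3 * M ^ t :=
      qNumericalRadius_le (by positivity) fun x y hx hy =>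
        hA.norm_inner_matRpow_le hα hM hAM ht hx hy
    calc _ ≤ ‖q‖ * ((1 / Real.cos α) ^ 3 * M ^ t) := by gcongr
      _ = (1 / Real.cos α) ^ 3 * (‖q‖ * M ^ t) := by ring
      _ ≤ _ := by gcongr; exact mul_rpow_le_rpow hq0 hq hM.le ht hMq
  · rintro γ ⟨hγ0, hγ1⟩
    have hγ1 : 0 < 1 - γ := by linarith
    have hconc : (1 - γ) * M ^ t + γ * N ^ t ≤ ((1 - γ) * M + γ * N) ^ t := by
      simpa using (Real.concaveOn_rpow ht0.le ht.2.le).2 (Set.mem_Ici.2 hM.le)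
        (Set.mem_Ici.2 hN.le) hγ1.le hγ0.le (by ring)
    have h1 : qNumericalRadius q ((1 - γ) • matRpow A t + γ • matRpow B t) ≤
        (1 / Real.cos α) ^ 3 * ((1 - γ) * M + γ * N) ^ t := by
      refine qNumericalRadius_le (by positivity) fun x y hx hy => ?_
      have a := hA.norm_inner_matRpow_le hα hM hAM ht hx hy
      have b := hB.norm_inner_matRpow_le hα hN hBN ht hx hy
      rw [RCLike.real_smul_eq_coe_smul (K := ℂ) (1 - γ), RCLike.real_smul_eq_coe_smul (K := ℂ) γ,
        map_add, map_smul, map_smul, add_apply, smul_apply, smul_apply, inner_add_right,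
        inner_smul_right, inner_smul_right]
      refine (norm_add_le _ _).trans ?_
      rw [norm_mul, norm_mul, RCLike.norm_of_nonneg hγ1.le, RCLike.norm_of_nonneg hγ0.le]
      calc _ ≤ (1 - γ) * ((1 / Real.cos α) ^ 3 * M ^ t) + γ * ((1 / Real.cos α) ^ 3 * N ^ t) := by
            gcongr
        _ = (1 / Real.cos α) ^ 3 * ((1 - γ) * M ^ t + γ * N ^ t) := by ring
        _ ≤ _ := by gcongr
    calc _ ≤ ‖q‖ * ((1 / Real.cos α) ^ 3 * ((1 - γ) * M + γ * N) ^ t) := by gcongr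
      _ = (1 / Real.cos α) ^ 3 * (‖q‖ * ((1 - γ) * M + γ * N) ^ t) := by ring
      _ ≤ _ := by
        gcongr
        refine mul_rpow_le_rpow hq0 hq (by positivity) ht ?_
        calc ‖q‖ * ((1 - γ) * M + γ * N) = (1 - γ) * (‖q‖ * M) + γ * (‖q‖ * N) := by ring
          _ ≤ _ := by gcongr
  · obtain ⟨L, hL, hABL, z, hz, hzL⟩ := (hA.add hB).exists_isMax_inner_re hunit
    have hsum : ∀ u : EuclideanSpace ℂ (Fin n),
        (inner ℂ u (Matrix.toEuclideanCLM (𝕜 := ℂ) (A + B) u)).re =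
          (inner ℂ u (Matrix.toEuclideanCLM (𝕜 := ℂ) A u)).re +
            (inner ℂ u (Matrix.toEuclideanCLM (𝕜 := ℂ) B u)).re := by
      intro u
      rw [map_add, add_apply, inner_add_right, Complex.add_re]
    -- Since `Re A, Re B ≥ 0`, the maximum `L` of `Re (A + B)` bounds each of them. The two lower
    -- bounds with this common `L` add up to `L^t` at the maximizer `z`.
    have hAL := hA.le_inner_matRpow hα hL
      (fun u => by linarith [hABL u, hsum u, hB.inner_re_nonneg u]) ht z
    have hBL := hB.le_inner_matRpow hα hL
      (fun u => by linarith [hABL u, hsum u, hA.inner_re_nonneg u]) ht z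
    have h1 : L ^ t ≤
        (inner ℂ z (Matrix.toEuclideanCLM (𝕜 := ℂ) (matRpow A t + matRpow B t) z)).re := by
      rw [map_add, add_apply, inner_add_right, Complex.add_re]
      refine le_trans (le_of_eq ?_) (add_le_add hAL hBL)
      rw [← add_mul, ← mul_add, ← hsum, hzL, inv_mul_cancel₀ hL.ne', one_mul]
    have h2 := norm_mul_inner_re_le_qNumericalRadius hq hne (matRpow A t + matRpow B t) hz
    have h3 : qNumericalRadius q (matRpow (A + B) t) ≤ (1 / Real.cos α) ^ 3 * L ^ t :=
      qNumericalRadius_le (by positivity) fun x y hx hy =>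
        (hA.add hB).norm_inner_matRpow_le hα hL hABL ht hx hy
    calc _ ≤ ‖q‖ * ((1 / Real.cos α) ^ 3 * L ^ t) := by gcongr
      _ = (1 / Real.cos α) ^ 3 * (‖q‖ * L ^ t) := by ring
      _ ≤ _ := by gcongr; exact (mul_le_mul_of_nonneg_left h1 hq0).trans h2
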